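/- Let $I,J,R$ be integers with $I>J\ge 2$ and $\min(I,2J)>R>J$. The rank of a real three-way array is the smallest number of rank-1 arrays (outer products $\mathbf a\circ\mathbf b\circ\mathbf c$ of three nonzero real vectors, with entries $a_ib_jc_k$) whose sum equals it. For $\mathcal Y\in\mathbb R^{I\times J\times 2}$ with frontal $I\times J$ slices $\mathbf Y_1,\mathbf Y_2$ let $[\mathbf Y_1\,|\,\mathbf Y_2]$ be its $I\times 2J$ matrix unfolding, let $\|\mathcal Y\|_F$ be its Frobenius norm (the square root of the sum of the squares of its entries), and put $$W_R(I,J,2)=\{\mathcal Y\in\mathbb R^{I\times J\times 2}:\ \operatorname{rank}([\mathbf Y_1\,|\,\mathbf Y_2])\le R\}.$$ Then for generic $\mathcal Z\in\mathbb R^{I\times J\times 2}$, that is, for all $\mathcal Z$ outside a set of Lebesgue measure zero, the problem $$\min_{\mathcal Y\in W_R(I,J,2)}\|\mathcal Z-\mathcal Y\|_F^2$$ has exactly one optimal solution $\mathcal X$, and $\mathcal X$ has (tensor) rank exactly $R$. -/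

import Mathlib

/-- Real `I × J × K` arrays; the entry `y_{ijk}` of `Y` is `Y (i, j, k)`. As a function space on a
finite index type it carries the usual Lebesgue measure `volume`. -/
abbrev ThreeWayArray (I J K : ℕ) : Type := Fin I × Fin J × Fin K → ℝ

namespace ThreeWayArray

variable {I J K : ℕ}

/-- The outer vector product `a ∘ b ∘ c`. -/
def outer (a : Fin I → ℝ) (b : Fin J → ℝ) (c : Fin K → ℝ) : ThreeWayArray I J K :=
  fun p => a p.1 * b p.2.1 * c p.2.2

/-- Rank-1 arrays: outer products of three nonzero vectors. -/
def IsRankOne (Y : ThreeWayArray I J K) : Prop :=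
  ∃ (a : Fin I → ℝ) (b : Fin J → ℝ) (c : Fin K → ℝ),
    a ≠ 0 ∧ b ≠ 0 ∧ c ≠ 0 ∧ Y = outer a b c

/-- `Y` is a sum of exactly `n` rank-1 arrays. -/
def IsSumOfRankOnes (Y : ThreeWayArray I J K) (n : ℕ) : Prop :=
  ∃ T : Fin n → ThreeWayArray I J K, (∀ r, IsRankOne (T r)) ∧ Y = ∑ r, T r

/-- Every array is a finite sum of rank-1 arrays, so that the infimum in `rank` is a minimum. -/
theorem exists_isSumOfRankOnes (Y : ThreeWayArray I J K) : ∃ n, IsSumOfRankOnes Y n := by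
  classical
  have key : ∀ p, Y p ≠ 0 → IsRankOne (Pi.single p (Y p) : ThreeWayArray I J K) := by
    rintro ⟨i, j, k⟩ hY
    refine ⟨Pi.single i (Y (i, j, k)), Pi.single j 1, Pi.single k 1, ?_, ?_, ?_, ?_⟩
    · simpa using hY
    · simp
    · simp
    · funext ⟨i', j', k'⟩
      by_cases h1 : i' = i <;> by_cases h2 : j' = j <;> by_cases h3 : k' = k <;>
        simp [outer, h1, h2, h3]
  let s : Finset (Fin I × Fin J × Fin K) := Finset.univ.filter fun p => Y p ≠ 0
  refine ⟨s.card, fun r => Pi.single (s.equivFin.symm r : Fin I × Fin J × Fin K)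
    (Y (s.equivFin.symm r)), fun r => ?_, ?_⟩
  · exact key _ (Finset.mem_filter.1 (s.equivFin.symm r).2).2
  · rw [Equiv.sum_comp s.equivFin.symm
      (fun q : s => (Pi.single (q : Fin I × Fin J × Fin K) (Y q) : ThreeWayArray I J K)),
      Finset.sum_coe_sort s
      (fun q => (Pi.single q (Y q) : ThreeWayArray I J K))]
    funext p
    simp only [Finset.sum_apply, Pi.single_apply]
    by_cases h : Y p = 0 <;> simp [s, h]

/-- The (tensor) rank: the smallest number of rank-1 arrays whose sum is `Y`. -/
noncomputable def rank (Y : ThreeWayArray I J K) : ℕ := sInf {n | IsSumOfRankOnes Y n}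

/-- The rank is attained and minimal. -/
theorem isLeast_rank (Y : ThreeWayArray I J K) : IsLeast {n | IsSumOfRankOnes Y n} Y.rank :=
  ⟨Nat.sInf_mem (exists_isSumOfRankOnes Y), fun _ h => Nat.sInf_le h⟩

/-- The Frobenius norm: the square root of the sum of the squares of the entries. -/
noncomputable def frobeniusNorm (Y : ThreeWayArray I J K) : ℝ := √(∑ p, Y p ^ 2)

/-- The `k`-th frontal slice, an `I × J` matrix. -/
def slice (Y : ThreeWayArray I J K) (k : Fin K) : Matrix (Fin I) (Fin J) ℝ :=
  Matrix.of fun i j => Y (i, j, k)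

/-- The `I × 2J` matrix unfolding `[Y₁ | Y₂]` of an `I × J × 2` array. -/
def unfolding (Y : ThreeWayArray I J 2) : Matrix (Fin I) (Fin J ⊕ Fin J) ℝ :=
  Matrix.fromCols (Y.slice 0) (Y.slice 1)

/-- The set `W_R(I,J,2)`: the unfolding has matrix rank at most `R`. -/
def W (I J R : ℕ) : Set (ThreeWayArray I J 2) := {Y | Y.unfolding.rank ≤ R}

/-- `X` is an optimal solution of the problem of minimizing `‖Z - Y‖_F²` over `Y ∈ W_R(I,J,2)`. -/
def IsOptimalSolution (R : ℕ) (Z X : ThreeWayArray I J 2) : Prop :=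
  X ∈ W I J R ∧ ∀ Y ∈ W I J R, frobeniusNorm (Z - X) ^ 2 ≤ frobeniusNorm (Z - Y) ^ 2

end ThreeWayArray

/-!
Almost every `Z` has a unique nearest point in the closed set `W_R`, because the distance to a set
is Lipschitz, hence differentiable almost everywhere, and its gradient determines the nearest point.

Let `X` be a nearest point. Its unfolding has rank `R`, since otherwise every rank-one direction
stays in `W_R` and `Z = X`; moreover `U = Z - X` satisfies `Xᵀ U = 0` and `U Xᵀ = 0`. For a suitable
order of the rows and columns `X = [1; E] N` with `N = [A | B]`, `A` invertible, and `U` is given by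
`A`, `B`, `E` and a matrix `D`: thus `Z` is the image of `(A, B, E, D)` under a polynomial map
between spaces of equal dimension. Such a map preserves null sets, so a generic `Z` comes from a
generic `R × 2J` pencil `N = [N₁ | N₂]`. Since `R > J`, every scalar `s` is a generalized left
eigenvalue of `N`, and for generic `N` eigenvectors for `R` distinct scalars form a basis. Expanding
the rows of `N` in the dual basis writes `X` as a sum of `R` rank-one arrays.
-/

open MeasureTheory Matrix Metric

theorem ae_ne_zero_of_analyticOnNhd_real {f : ℝ → ℝ} (hf : AnalyticOnNhd ℝ f Set.univ) {t₀ : ℝ}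
    (h₀ : f t₀ ≠ 0) : ∀ᵐ t, f t ≠ 0 := by
  have h := ae_restrict_le_codiscreteWithin (μ := volume) MeasurableSet.univ
    (hf.preimage_zero_mem_codiscrete h₀)
  rwa [Measure.restrict_univ] at h

section GenericNonvanishing

variable {E : Type*} [NormedAddCommGroup E] [NormedSpace ℝ E] [FiniteDimensional ℝ E]
  [MeasurableSpace E] [BorelSpace E] (μ : Measure E) [μ.IsAddHaarMeasure]

theorem ae_ne_zero_of_analyticOnNhd {f : E → ℝ} (hf : AnalyticOnNhd ℝ f Set.univ) {x₀ : E}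
    (h₀ : f x₀ ≠ 0) : ∀ᵐ x ∂μ, f x ≠ 0 := by
  have hcont : Continuous f := continuousOn_univ.1 hf.continuousOn
  have hmeas : MeasurableSet {q : E × ℝ | f (x₀ + q.2 • q.1) ≠ 0} :=
    (isOpen_ne_fun (by fun_prop) continuous_const).measurableSet
  have hline : ∀ᵐ y ∂μ, ∀ᵐ t : ℝ, f (x₀ + t • y) ≠ 0 := .of_forall fun y =>
    ae_ne_zero_of_analyticOnNhd_real (t₀ := 0)
      (hf.comp (g := f) (f := fun t : ℝ => x₀ + t • y) (fun t _ => by fun_prop)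
        (Set.mapsTo_univ _ _))
      (by simpa using h₀)
  rw [Measure.ae_ae_comm hmeas] at hline
  obtain ⟨t, ht, ht₀⟩ := (hline.and (Measure.ae_ne volume (0 : ℝ))).exists
  have hnull : μ ((t • ·) ⁻¹' ((x₀ + ·) ⁻¹' {x | ¬ f x ≠ 0})) = 0 := ae_iff.1 ht
  rw [Measure.addHaar_preimage_smul μ ht₀, measure_preimage_add] at hnull
  exact ae_iff.2 ((mul_eq_zero.1 hnull).resolve_left (by simp [ht₀]))

end GenericNonvanishing

section Nearest

variable {E : Type*} [NormedAddCommGroup E] [InnerProductSpace ℝ E] {s : Set E} {x y : E}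

/-- A point of `s` at minimal distance from `x`. -/
def IsNearestPoint (s : Set E) (x y : E) : Prop :=
  y ∈ s ∧ dist x y = infDist x s

theorem IsNearestPoint.fderiv_infDist_sq (hy : IsNearestPoint s x y)
    (hd : DifferentiableAt ℝ (infDist · s) x) :
    fderiv ℝ (fun z => infDist z s ^ 2) x = (2 : ℝ) • innerSL ℝ (x - y) := by
  have hmin : IsLocalMin (fun z => ‖z - y‖ ^ 2 - infDist z s ^ 2) x := by
    refine .of_forall fun z => ?_
    have hz : infDist z s ≤ ‖z - y‖ := dist_eq_norm z y ▸ infDist_le_dist_of_mem hy.1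
    have := pow_le_pow_left₀ infDist_nonneg hz 2
    simp only [← dist_eq_norm, hy.2, sub_self] at this ⊢
    linarith
  have hnorm : HasFDerivAt (fun z => ‖z - y‖ ^ 2) ((2 : ℝ) • innerSL ℝ (x - y)) x := by
    simpa [ofNat_smul_eq_nsmul] using ((hasFDerivAt_id x).sub_const y).norm_sq
  have hdist : HasFDerivAt (fun z => infDist z s ^ 2) _ x := (hd.pow 2).hasFDerivAt
  exact (sub_eq_zero.1 (hmin.hasFDerivAt_eq_zero (hnorm.sub hdist))).symm

theorem IsNearestPoint.unique {y' : E} (hd : DifferentiableAt ℝ (infDist · s) x)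
    (hy : IsNearestPoint s x y) (hy' : IsNearestPoint s x y') : y = y' := by
  have h := (hy.fderiv_infDist_sq hd).symm.trans (hy'.fderiv_infDist_sq hd)
  exact sub_right_injective ((innerSL_inj (𝕜 := ℝ)).1 (smul_right_injective _ two_ne_zero h))

theorem ae_existsUnique_isNearestPoint [FiniteDimensional ℝ E] [MeasurableSpace E] [BorelSpace E]
    (μ : Measure E) [μ.IsAddHaarMeasure] (hs : IsClosed s) (hne : s.Nonempty) :
    ∀ᵐ x ∂μ, ∃! y, IsNearestPoint s x y := by
  filter_upwards [(lipschitz_infDist_pt s).ae_differentiableAt (μ := μ)] with x hx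
  obtain ⟨y, hys, hy⟩ := hs.exists_infDist_eq_dist hne x
  exact ⟨y, ⟨hys, hy.symm⟩, fun y' hy' => hy'.unique hx ⟨hys, hy.symm⟩⟩

theorem IsNearestPoint.inner_eq_zero_of_line_mem {v : E} (hy : IsNearestPoint s x y)
    (hv : ∀ t : ℝ, y + t • v ∈ s) : inner ℝ (x - y) v = 0 := by
  have hquad : ∀ t : ℝ, 0 ≤ ‖v‖ ^ 2 * (t * t) + (-2 * inner ℝ (x - y) v) * t + 0 := fun t => by
    have h : ‖x - y‖ ≤ ‖x - y - t • v‖ := by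
      rw [sub_sub, ← dist_eq_norm, ← dist_eq_norm, hy.2]
      exact infDist_le_dist_of_mem (hv t)
    have h := pow_le_pow_left₀ (norm_nonneg _) h 2
    rw [norm_sub_sq_real (x - y), inner_smul_right, norm_smul, mul_pow, Real.norm_eq_abs,
      sq_abs] at h
    linarith
  have h := discrim_le_zero hquad
  rw [discrim] at h
  nlinarith

end Nearest

section Analytic

variable {E : Type*} [NormedAddCommGroup E] [NormedSpace ℝ E]

/-- Matrix-valued functions all of whose entries are real analytic; `Matrix` carries no canonical
norm. -/
def IsEntrywiseAnalytic {m n : Type*} (A : E → Matrix m n ℝ) : Prop :=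
  ∀ i j, AnalyticOnNhd ℝ (fun x => A x i j) Set.univ

namespace IsEntrywiseAnalytic

variable {l m n o p : Type*}

theorem linearMap [FiniteDimensional ℝ E] (φ : E →ₗ[ℝ] Matrix m n ℝ) :
    IsEntrywiseAnalytic fun x => φ x := fun i j =>
  (LinearMap.toContinuousLinearMap (entryLinearMap ℝ ℝ i j ∘ₗ φ)).analyticOnNhd _

theorem const (A : Matrix m n ℝ) : IsEntrywiseAnalytic fun _ : E => A :=
  fun _ _ => analyticOnNhd_const

variable {A B : E → Matrix m n ℝ}

theorem submatrix (hA : IsEntrywiseAnalytic A) (f : l → m) (g : o → n) :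
    IsEntrywiseAnalytic fun x => (A x).submatrix f g :=
  fun i j => hA (f i) (g j)

theorem transpose (hA : IsEntrywiseAnalytic A) : IsEntrywiseAnalytic fun x => (A x)ᵀ :=
  fun i j => hA j i

theorem neg (hA : IsEntrywiseAnalytic A) : IsEntrywiseAnalytic fun x => -A x :=
  fun i j => (hA i j).neg

theorem add (hA : IsEntrywiseAnalytic A) (hB : IsEntrywiseAnalytic B) :
    IsEntrywiseAnalytic fun x => A x + B x :=
  fun i j => (hA i j).add (hB i j)

theorem sub (hA : IsEntrywiseAnalytic A) (hB : IsEntrywiseAnalytic B) :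
    IsEntrywiseAnalytic fun x => A x - B x :=
  fun i j => (hA i j).sub (hB i j)

theorem smul {f : E → ℝ} (hf : AnalyticOnNhd ℝ f Set.univ) (hA : IsEntrywiseAnalytic A) :
    IsEntrywiseAnalytic fun x => f x • A x :=
  fun i j => hf.mul (hA i j)

theorem fromRows {B : E → Matrix l n ℝ} (hA : IsEntrywiseAnalytic A)
    (hB : IsEntrywiseAnalytic B) : IsEntrywiseAnalytic fun x => fromRows (A x) (B x)
  | .inl i, j => hA i j
  | .inr i, j => hB i j

theorem fromCols {B : E → Matrix m l ℝ} (hA : IsEntrywiseAnalytic A)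
    (hB : IsEntrywiseAnalytic B) : IsEntrywiseAnalytic fun x => fromCols (A x) (B x)
  | i, .inl j => hA i j
  | i, .inr j => hB i j

theorem mul [Fintype n] {B : E → Matrix n o ℝ} (hA : IsEntrywiseAnalytic A)
    (hB : IsEntrywiseAnalytic B) : IsEntrywiseAnalytic fun x => A x * B x := fun i j => by
  simp only [mul_apply]
  exact Finset.analyticOnNhd_fun_sum _ fun k _ => (hA i k).mul (hB k j)

theorem det [Fintype n] [DecidableEq n] {A : E → Matrix n n ℝ} (hA : IsEntrywiseAnalytic A) :
    AnalyticOnNhd ℝ (fun x => (A x).det) Set.univ := by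
  simp only [det_apply']
  exact Finset.analyticOnNhd_fun_sum _ fun σ _ =>
    analyticOnNhd_const.mul (Finset.analyticOnNhd_fun_prod _ fun i _ => hA (σ i) i)

theorem updateRow [DecidableEq m] (hA : IsEntrywiseAnalytic A) (i : m) (v : n → ℝ) :
    IsEntrywiseAnalytic fun x => (A x).updateRow i v := fun i' j => by
  by_cases h : i' = i
  · simpa [h] using analyticOnNhd_const
  · simpa [updateRow_ne h] using hA i' j

theorem adjugate [Fintype n] [DecidableEq n] {A : E → Matrix n n ℝ}
    (hA : IsEntrywiseAnalytic A) : IsEntrywiseAnalytic fun x => (A x).adjugate := fun i j => by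
  simp only [adjugate_apply]
  exact (hA.updateRow j _).det

end IsEntrywiseAnalytic

end Analytic

section Rank

variable {m n K : Type*} [Field K]

theorem rank_add_le_rank_add_rank [Finite m] [Fintype n] (A B : Matrix m n K) :
    (A + B).rank ≤ A.rank + B.rank := by
  rw [Matrix.rank, mulVecLin_add]
  exact (Submodule.finrank_mono (LinearMap.range_add_le _ _)).trans
    (Submodule.finrank_add_le_finrank_add_finrank _ _)

variable {ρ π δ : Type*} [Fintype m] [Fintype n] [Fintype ρ] [Fintype π] [Fintype δ]

theorem exists_sumEquiv_apply_inl_eq {g : ρ → m} (hg : Function.Injective g)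
    (hm : Fintype.card m = Fintype.card ρ + Fintype.card π) :
    ∃ f : ρ ⊕ π ≃ m, ∀ r, f (.inl r) = g r := by
  classical
  have hcard : Fintype.card π = Fintype.card ↥(Set.range g)ᶜ := by
    rw [Fintype.card_compl_set, Set.card_range_of_injective hg, hm, Nat.add_sub_cancel_left]
  exact ⟨(Equiv.sumCongr (Equiv.ofInjective g hg) (Fintype.equivOfCardEq hcard)).trans
    (Equiv.Set.sumCompl _), fun _ => rfl⟩

variable [DecidableEq ρ]

theorem exists_submatrix_eq_fromRows_one_mul (X : Matrix m n K) (hX : X.rank = Fintype.card ρ)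
    (hm : Fintype.card m = Fintype.card ρ + Fintype.card π) :
    ∃ (f : ρ ⊕ π ≃ m) (E : Matrix π ρ K),
      LinearIndependent K (X.submatrix (f ∘ Sum.inl) id).row ∧
        X.submatrix f id = fromRows 1 E * X.submatrix (f ∘ Sum.inl) id := by
  obtain ⟨κ, a, ha, hspan, hli⟩ := exists_linearIndependent' K X.row
  have : Fintype κ := Fintype.ofInjective a ha
  have hκ : Fintype.card ρ = Fintype.card κ := by
    rw [← hX, rank_eq_finrank_span_row, ← hspan, finrank_span_eq_card hli]
  obtain ⟨e⟩ := Fintype.card_eq.1 hκ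
  obtain ⟨f, hf⟩ := exists_sumEquiv_apply_inl_eq (ha.comp e.injective) hm
  have hrow : (X.submatrix (f ∘ Sum.inl) id).row = (X.row ∘ a) ∘ e :=
    funext fun r => congrArg X.row (hf r)
  have hmem (i : π) : ∃ c : ρ → K, c ᵥ* X.submatrix (f ∘ Sum.inl) id = X.row (f (.inr i)) := by
    have : X.row (f (.inr i)) ∈
        Submodule.span K (Set.range (X.submatrix (f ∘ Sum.inl) id).row) := by
      rw [hrow, e.surjective.range_comp, hspan]
      exact Submodule.subset_span ⟨_, rfl⟩
    rwa [← range_vecMulLinear] at this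
  choose c hc using hmem
  refine ⟨f, of c, hrow ▸ hli.comp e e.injective, ?_⟩
  rw [fromRows_mul, Matrix.one_mul]
  ext (i | i) j
  · rfl
  · exact (congrFun (hc i) j).symm

theorem exists_submatrix_eq_fromRows_mul_fromCols (X : Matrix m n K)
    (hX : X.rank = Fintype.card ρ) (hm : Fintype.card m = Fintype.card ρ + Fintype.card π)
    (hn : Fintype.card n = Fintype.card ρ + Fintype.card δ) :
    ∃ (f : ρ ⊕ π ≃ m) (e : ρ ⊕ δ ≃ n) (A : Matrix ρ ρ K) (B : Matrix ρ δ K) (E : Matrix π ρ K),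
      A.det ≠ 0 ∧ X.submatrix f e = fromRows 1 E * fromCols A B := by
  obtain ⟨f, E, hli, hE⟩ := exists_submatrix_eq_fromRows_one_mul X hX hm
  set Y := X.submatrix (f ∘ Sum.inl) id
  obtain ⟨e, -, hA, -⟩ := exists_submatrix_eq_fromRows_one_mul Yᵀ
    ((rank_transpose Y).trans hli.rank_matrix) hn
  refine ⟨f, e, Y.submatrix id (e ∘ Sum.inl), Y.submatrix id (e ∘ Sum.inr), E, ?_, ?_⟩
  · rw [← isUnit_iff_ne_zero, ← isUnit_iff_isUnit_det]
    exact linearIndependent_cols_iff_isUnit.1 hA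
  · have hY : Y.submatrix id e =
        fromCols (Y.submatrix id (e ∘ Sum.inl)) (Y.submatrix id (e ∘ Sum.inr)) := by
      ext i (j | j) <;> rfl
    rw [← hY]
    exact congrArg (fun M => M.submatrix id e) hE

end Rank

theorem isClosed_setOf_rank_le {m n 𝕜 : Type*} [Finite m] [Fintype n] [NontriviallyNormedField 𝕜]
    [CompleteSpace 𝕜] (R : ℕ) : IsClosed {A : Matrix m n 𝕜 | A.rank ≤ R} := by
  rw [← isOpen_compl_iff, isOpen_iff_mem_nhds]
  intro A hA
  obtain ⟨κ, a, ha, hspan, hli⟩ := exists_linearIndependent' 𝕜 A.row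
  have : Finite κ := Finite.of_injective a ha
  have : Fintype κ := Fintype.ofFinite κ
  have hκ : Fintype.card κ = A.rank := by
    rw [rank_eq_finrank_span_row, ← hspan, finrank_span_eq_card hli]
  have hopen : IsOpen {B : Matrix m n 𝕜 | LinearIndependent 𝕜 (B.submatrix a id).row} :=
    (isOpen_setOfPred_linearIndependent (𝕜 := 𝕜) (E := n → 𝕜) (ι := κ)).preimage
      (f := fun B : Matrix m n 𝕜 => (B.submatrix a id).row)
      (continuous_pi fun k => continuous_apply (a k))
  filter_upwards [hopen.mem_nhds hli] with B hB hBR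
  have hκB : Fintype.card κ ≤ B.rank :=
    (LinearIndependent.rank_matrix hB).symm.trans_le (rank_submatrix_le B a (Equiv.refl n))
  exact hA ((hκ.symm.trans_le hκB).trans hBR)

section NormalForm

variable {ρ π δ n K : Type*} [Field K]

theorem eq_fromRows_mul_of_transpose_fromRows_mul_eq_zero [Fintype ρ] [DecidableEq ρ]
    [Fintype π] [DecidableEq π] {E : Matrix π ρ K}
    {U : Matrix (ρ ⊕ π) n K} (h : (fromRows (1 : Matrix ρ ρ K) E)ᵀ * U = 0) :
    U = fromRows (-Eᵀ) 1 * U.toRows₂ := by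
  conv_rhs => rw [fromRows_mul, Matrix.one_mul, Matrix.neg_mul]
  rw [← fromRows_toRows U, transpose_fromRows, fromCols_mul_fromRows, transpose_one,
    Matrix.one_mul] at h
  conv_lhs => rw [← fromRows_toRows U, eq_neg_of_add_eq_zero_left h]

theorem eq_mul_fromCols_of_mul_transpose_fromCols_eq_zero [Fintype ρ] [DecidableEq ρ]
    [Fintype δ] [DecidableEq δ] {A : Matrix ρ ρ K} (hA : A.det ≠ 0) {B : Matrix ρ δ K}
    {U : Matrix n (ρ ⊕ δ) K} (h : U * (fromCols A B)ᵀ = 0) :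
    U = (A.det⁻¹ • U.toCols₂) * fromCols (-(A.adjugate * B)ᵀ) (A.det • 1) := by
  rw [← fromCols_toCols U, transpose_fromCols, fromCols_mul_fromRows] at h
  have hadj : A.det • U.toCols₁ = -(U.toCols₂ * (A.adjugate * B)ᵀ) := by
    have := congrArg (· * A.adjugateᵀ) (eq_neg_of_add_eq_zero_left h)
    simpa [Matrix.mul_assoc, ← transpose_mul, adjugate_mul] using this
  rw [Matrix.smul_mul, mul_fromCols, Matrix.mul_neg, ← hadj, Matrix.mul_smul, Matrix.mul_one]
  conv_lhs => rw [← fromCols_toCols U]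
  ext i (j | j) <;> simp [hA]

variable [Fintype ρ] [DecidableEq ρ] [Fintype π] [DecidableEq π] [Fintype δ] [DecidableEq δ]

/-- Sends `[[A, B], [E, D]]` to `X + U`, where `X = [1; E] [A | B]` has rank at most `card ρ` and
`U = [-Eᵀ; 1] D [-(adj A B)ᵀ | det A]` satisfies `Xᵀ U = 0` and `U Xᵀ = 0`, that is, `U` is normal
at `X` to the matrices of rank `card ρ`. The adjugate replaces the inverse of `A` so that the map is
polynomial. -/
def normalForm (M : Matrix (ρ ⊕ π) (ρ ⊕ δ) K) : Matrix (ρ ⊕ π) (ρ ⊕ δ) K :=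
  fromRows 1 M.toBlocks₂₁ * fromCols M.toBlocks₁₁ M.toBlocks₁₂ +
    fromRows (-M.toBlocks₂₁ᵀ) 1 * (M.toBlocks₂₂ *
      fromCols (-(M.toBlocks₁₁.adjugate * M.toBlocks₁₂)ᵀ) (M.toBlocks₁₁.det • 1))

theorem exists_eq_normalForm {A : Matrix ρ ρ K} (hA : A.det ≠ 0) (B : Matrix ρ δ K)
    (E : Matrix π ρ K) {U : Matrix (ρ ⊕ π) (ρ ⊕ δ) K}
    (hleft : (fromRows (1 : Matrix ρ ρ K) E * fromCols A B)ᵀ * U = 0)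
    (hright : U * (fromRows (1 : Matrix ρ ρ K) E * fromCols A B)ᵀ = 0) :
    ∃ D, fromRows 1 E * fromCols A B + U = normalForm (fromBlocks A B E D) := by
  have hE : (fromRows (1 : Matrix ρ ρ K) E)ᵀ * U = 0 := by
    have hu : IsUnit Aᵀ.det := isUnit_det_transpose A (isUnit_iff_ne_zero.2 hA)
    rw [transpose_mul, Matrix.mul_assoc, transpose_fromCols, fromRows_mul] at hleft
    have h : Aᵀ * ((fromRows (1 : Matrix ρ ρ K) E)ᵀ * U) = 0 := congrArg toRows₁ hleft
    rw [← nonsing_inv_mul_cancel_left _ ((fromRows 1 E)ᵀ * U) hu, h, Matrix.mul_zero]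
  have hB : U.toRows₂ * (fromCols A B)ᵀ = 0 := by
    rw [transpose_mul, ← Matrix.mul_assoc, transpose_fromRows, transpose_one, mul_fromCols,
      Matrix.mul_one] at hright
    exact congrArg (fun M => M.toCols₁.toRows₂) hright
  refine ⟨A.det⁻¹ • U.toRows₂.toCols₂, ?_⟩
  simp only [normalForm, toBlocks_fromBlocks₁₁, toBlocks_fromBlocks₁₂, toBlocks_fromBlocks₂₁,
    toBlocks_fromBlocks₂₂]
  rw [← eq_mul_fromCols_of_mul_transpose_fromCols_eq_zero hA hB,
    ← eq_fromRows_mul_of_transpose_fromRows_mul_eq_zero hE]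

theorem IsEntrywiseAnalytic.normalForm {E : Type*} [NormedAddCommGroup E]
    [NormedSpace ℝ E] {M : E → Matrix (ρ ⊕ π) (ρ ⊕ δ) ℝ} (hM : IsEntrywiseAnalytic M) :
    IsEntrywiseAnalytic fun x => normalForm (M x) := by
  have h₁₁ : IsEntrywiseAnalytic fun x => (M x).toBlocks₁₁ := hM.submatrix _ _
  have h₁₂ : IsEntrywiseAnalytic fun x => (M x).toBlocks₁₂ := hM.submatrix _ _
  have h₂₁ : IsEntrywiseAnalytic fun x => (M x).toBlocks₂₁ := hM.submatrix _ _
  have h₂₂ : IsEntrywiseAnalytic fun x => (M x).toBlocks₂₂ := hM.submatrix _ _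
  exact (((IsEntrywiseAnalytic.const 1).fromRows h₂₁).mul (h₁₁.fromCols h₁₂)).add
    ((h₂₁.transpose.neg.fromRows (.const 1)).mul
      (h₂₂.mul ((h₁₁.adjugate.mul h₁₂).transpose.neg.fromCols (.smul h₁₁.det (.const 1)))))

end NormalForm

theorem adjugate_apply_eq_det_smul_of_row_eq_single {ρ K : Type*} [Fintype ρ] [DecidableEq ρ]
    [CommRing K] {A : Matrix ρ ρ K} {i r : ρ} (h : A.row r = Pi.single i 1) :
    A.adjugate i = A.det • Pi.single r 1 := by
  have h' : Pi.single r 1 ᵥ* A = Pi.single i 1 := by rw [single_one_vecMul, h]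
  calc A.adjugate i = Pi.single i 1 ᵥ* A.adjugate := by rw [single_one_vecMul]; rfl
    _ = A.det • Pi.single r 1 := by
      rw [← h', vecMul_vecMul, mul_adjugate, vecMul_smul, vecMul_one]

section Pencil

variable {n κ K : Type*}

/-- The rectangular pencil `N = [N₁ | N₂]` is diagonalizable from the left: some basis of row
vectors `g_r`, the rows of `G`, consists of generalized eigenvectors, `g_r N₁ = s_r g_r N₂`. -/
def HasLeftEigenbasis {ρ : Type*} [Fintype ρ] [DecidableEq ρ] [CommRing K]
    (N : Matrix ρ (n ⊕ n) K) : Prop :=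
  ∃ (G : Matrix ρ ρ K) (s : ρ → K), IsUnit G.det ∧
    G * N.toCols₁ = diagonal s * (G * N.toCols₂)

variable [Fintype n] [DecidableEq n] [Fintype κ] [DecidableEq κ]

/-- The matrix `N₁ - s N₂` of the pencil `N = [N₁ | N₂]`, made square by the columns `T`. -/
def borderedPencil [CommRing K] (s : K) (T : Matrix (n ⊕ κ) κ K) (N : Matrix (n ⊕ κ) (n ⊕ n) K) :
    Matrix (n ⊕ κ) (n ⊕ κ) K :=
  fromCols (N.toCols₁ - s • N.toCols₂) T

/-- Row `r` is the row of the adjugate of `[N₁ - s_r N₂ | T_r]` that belongs to the column `k` of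
`T_r`. It annihilates `N₁ - s_r N₂`, so it is a generalized left eigenvector of `N` whenever it is
nonzero, and it depends polynomially on `N`. -/
def leftEigenmatrix [CommRing K] (s : n ⊕ κ → K) (T : n ⊕ κ → Matrix (n ⊕ κ) κ K) (k : κ)
    (N : Matrix (n ⊕ κ) (n ⊕ n) K) : Matrix (n ⊕ κ) (n ⊕ κ) K :=
  of fun r => (borderedPencil (s r) (T r) N).adjugate (.inr k)

theorem leftEigenmatrix_mul_toCols₁ [CommRing K] (s : n ⊕ κ → K) (T : n ⊕ κ → Matrix (n ⊕ κ) κ K)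
    (k : κ) (N : Matrix (n ⊕ κ) (n ⊕ n) K) :
    leftEigenmatrix s T k N * N.toCols₁ = diagonal s * (leftEigenmatrix s T k N * N.toCols₂) := by
  ext r j
  have h : ((borderedPencil (s r) (T r) N).adjugate * borderedPencil (s r) (T r) N)
      (.inr k) (.inl j) = 0 := by simp [adjugate_mul]
  rw [borderedPencil, mul_fromCols, fromCols_apply_inl, ← borderedPencil, Matrix.mul_sub,
    Matrix.mul_smul, Matrix.sub_apply, sub_eq_zero] at h
  rw [diagonal_mul]
  exact h

theorem hasLeftEigenbasis_of_det_leftEigenmatrix_ne_zero [Field K] {s : n ⊕ κ → K}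
    {T : n ⊕ κ → Matrix (n ⊕ κ) κ K} {k : κ} {N : Matrix (n ⊕ κ) (n ⊕ n) K}
    (h : (leftEigenmatrix s T k N).det ≠ 0) : HasLeftEigenbasis N :=
  ⟨_, s, isUnit_iff_ne_zero.2 h, leftEigenmatrix_mul_toCols₁ s T k N⟩

/-- The pencil `[diag(s) M | M]`, where `M` is the identity stacked on a matrix whose only nonzero
row, the `k`-th, consists of ones. The standard basis is a left eigenbasis, and bordering by
`eigenbasisBorder` recovers it as `leftEigenmatrix`, up to nonzero factors. -/
def eigenbasisWitness [CommRing K] (s : n ⊕ κ → K) (k : κ) : Matrix (n ⊕ κ) (n ⊕ n) K :=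
  let M : Matrix (n ⊕ κ) n K := fromRows 1 (of fun l _ => if l = k then 1 else 0)
  fromCols (diagonal s * M) M

/-- The columns `κ` of the identity, with the column `k` traded for the column `r`. -/
def eigenbasisBorder [CommRing K] (k : κ) (r : n ⊕ κ) : Matrix (n ⊕ κ) κ K :=
  (1 : Matrix (n ⊕ κ) (n ⊕ κ) K).submatrix id (Equiv.swap (.inr k) r ∘ Sum.inr)

theorem vecMul_borderedPencil_eigenbasisWitness_inl [CommRing K] (s : n ⊕ κ → K) (k : κ) (t : K)
    (T : Matrix (n ⊕ κ) κ K) (v : n ⊕ κ → K) (j : n) :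
    (v ᵥ* borderedPencil t T (eigenbasisWitness s k)) (.inl j) =
      v (.inl j) * (s (.inl j) - t) + v (.inr k) * (s (.inr k) - t) := by
  simp only [borderedPencil, eigenbasisWitness, toCols₁_fromCols, toCols₂_fromCols,
    vecMul_fromCols, Sum.elim_inl, vecMul_sub, vecMul_smul, Pi.sub_apply, Pi.smul_apply]
  simp [vecMul, dotProduct, diagonal_mul, one_apply]
  ring

theorem vecMul_borderedPencil_eigenbasisBorder_inr [CommRing K] (k : κ) (t : K) (r : n ⊕ κ)
    (N : Matrix (n ⊕ κ) (n ⊕ n) K) (v : n ⊕ κ → K) (l : κ) :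
    (v ᵥ* borderedPencil t (eigenbasisBorder k r) N) (.inr l) =
      v (Equiv.swap (.inr k) r (.inr l)) := by
  simp [borderedPencil, eigenbasisBorder, vecMul, dotProduct, one_apply]

theorem row_borderedPencil_eigenbasisWitness [CommRing K] (s : n ⊕ κ → K) (k : κ) (r : n ⊕ κ) :
    (borderedPencil (s r) (eigenbasisBorder k r) (eigenbasisWitness s k)).row r =
      Pi.single (.inr k) 1 := by
  rw [← single_one_vecMul]
  ext (j | l)
  · rw [vecMul_borderedPencil_eigenbasisWitness_inl]
    rcases r with j' | l'
    · obtain rfl | h := eq_or_ne j j' <;> simp [*]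
    · obtain rfl | h := eq_or_ne k l' <;> simp [*]
  · simp [vecMul_borderedPencil_eigenbasisBorder_inr, Pi.single_apply, Equiv.swap_apply_eq_iff]

theorem det_borderedPencil_eigenbasisWitness_ne_zero [Field K] {s : n ⊕ κ → K}
    (hs : Function.Injective s) (k : κ) (r : n ⊕ κ) :
    (borderedPencil (s r) (eigenbasisBorder k r) (eigenbasisWitness s k)).det ≠ 0 := by
  rw [Ne, ← exists_vecMul_eq_zero_iff]
  rintro ⟨v, hv, hv0⟩
  have hinl j :=
    (vecMul_borderedPencil_eigenbasisWitness_inl s k (s r) _ v j).symm.trans (congrFun hv0 (.inl j))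
  have hinr l : v (Equiv.swap (.inr k) r (.inr l)) = 0 :=
    (vecMul_borderedPencil_eigenbasisBorder_inr k (s r) r _ v l).symm.trans (congrFun hv0 (.inr l))
  have hr : v r = 0 := by simpa using hinr k
  have hne {i : n ⊕ κ} (hi : i ≠ r) : s i - s r ≠ 0 := sub_ne_zero.2 (hs.ne hi)
  have hk : v (.inr k) = 0 := by
    rcases r with j | l
    · simpa [hr, hne Sum.inr_ne_inl] using hinl j
    · simpa using hinr l
  refine hv (funext ?_)
  rintro (j | l)
  · by_cases hj : .inl j = r
    · exact hj ▸ hr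
    · simpa [hk, hne hj] using hinl j
  · by_cases hl : .inr l = r
    · exact hl ▸ hr
    · by_cases hlk : l = k
      · exact hlk ▸ hk
      · simpa [Equiv.swap_apply_of_ne_of_ne (Sum.inr_injective.ne hlk) hl] using hinr l

theorem det_leftEigenmatrix_eigenbasisWitness_ne_zero [Field K] {s : n ⊕ κ → K}
    (hs : Function.Injective s) (k : κ) :
    (leftEigenmatrix s (eigenbasisBorder k) k (eigenbasisWitness s k)).det ≠ 0 := by
  have h : leftEigenmatrix s (eigenbasisBorder k) k (eigenbasisWitness s k) =
      diagonal fun r =>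
        (borderedPencil (s r) (eigenbasisBorder k r) (eigenbasisWitness s k)).det := by
    ext r i
    rw [leftEigenmatrix, of_apply, adjugate_apply_eq_det_smul_of_row_eq_single
      (row_borderedPencil_eigenbasisWitness s k r)]
    simp [diagonal_apply, Pi.single_apply, eq_comm]
  rw [h, det_diagonal, Finset.prod_ne_zero_iff]
  exact fun r _ => det_borderedPencil_eigenbasisWitness_ne_zero hs k r

theorem IsEntrywiseAnalytic.leftEigenmatrix {E : Type*} [NormedAddCommGroup E]
    [NormedSpace ℝ E] {N : E → Matrix (n ⊕ κ) (n ⊕ n) ℝ} (hN : IsEntrywiseAnalytic N)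
    (s : n ⊕ κ → ℝ) (T : n ⊕ κ → Matrix (n ⊕ κ) κ ℝ) (k : κ) :
    IsEntrywiseAnalytic fun x => leftEigenmatrix s T k (N x) := fun r => by
  have h₁ : IsEntrywiseAnalytic fun x => (N x).toCols₁ := hN.submatrix id Sum.inl
  have h₂ : IsEntrywiseAnalytic fun x => (N x).toCols₂ := hN.submatrix id Sum.inr
  have h : IsEntrywiseAnalytic fun x => borderedPencil (s r) (T r) (N x) :=
    (h₁.sub (.smul analyticOnNhd_const h₂)).fromCols (.const (T r))
  exact h.adjugate (.inr k)

end Pencil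

namespace ThreeWayArray

variable {I J K R : ℕ}

section Unfolding

/-- The matrix unfolding as a linear equivalence. -/
def unfoldingEquiv : ThreeWayArray I J 2 ≃ₗ[ℝ] Matrix (Fin I) (Fin J ⊕ Fin J) ℝ where
  toFun := unfolding
  map_add' _ _ := by ext i (j | j) <;> rfl
  map_smul' _ _ := by ext i (j | j) <;> rfl
  invFun M q := M q.1 (if q.2.2 = 0 then .inl q.2.1 else .inr q.2.1)
  left_inv Y := by
    funext ⟨i, j, k⟩
    fin_cases k <;> rfl
  right_inv M := by ext i (j | j) <;> rfl

theorem unfoldingEquiv_apply (Y : ThreeWayArray I J 2) : unfoldingEquiv Y = Y.unfolding := rfl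

theorem isEntrywiseAnalytic_unfolding :
    IsEntrywiseAnalytic (unfolding : ThreeWayArray I J 2 → Matrix (Fin I) (Fin J ⊕ Fin J) ℝ) :=
  .linearMap unfoldingEquiv.toLinearMap

theorem differentiable_of_isEntrywiseAnalytic_unfolding {E : Type*} [NormedAddCommGroup E]
    [NormedSpace ℝ E] {F : E → ThreeWayArray I J 2}
    (hF : IsEntrywiseAnalytic fun x => (F x).unfolding) : Differentiable ℝ F := by
  refine differentiable_pi.2 fun ⟨i, j, k⟩ => ?_
  fin_cases k
  · exact differentiableOn_univ.1 (hF i (.inl j)).differentiableOn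
  · exact differentiableOn_univ.1 (hF i (.inr j)).differentiableOn

theorem inner_toLp_eq_trace (U V : ThreeWayArray I J 2) :
    inner ℝ (WithLp.toLp 2 U) (WithLp.toLp 2 V) = trace (U.unfolding * V.unfoldingᵀ) := by
  simp [PiLp.inner_apply, trace, Matrix.mul_apply, Fintype.sum_prod_type, Fin.sum_univ_two,
    Finset.sum_add_distrib, unfolding, slice, mul_comm]

end Unfolding

section Rank

theorem rank_sum_outer_le {ρ : Type*} [Fintype ρ] (a : ρ → Fin I → ℝ) (b : ρ → Fin J → ℝ)
    (c : ρ → Fin K → ℝ) : (∑ r, outer (a r) (b r) (c r)).rank ≤ Fintype.card ρ := by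
  classical
  let T r := outer (a r) (b r) (c r)
  let s : Finset ρ := {r | T r ≠ 0}
  suffices h : IsSumOfRankOnes (∑ r, T r) s.card from
    ((isLeast_rank _).2 h).trans s.card_le_univ
  refine ⟨fun i => T (s.equivFin.symm i), fun i => ?_, ?_⟩
  · have h : T (s.equivFin.symm i) ≠ 0 := (Finset.mem_filter.1 (s.equivFin.symm i).2).2
    refine ⟨_, _, _, ?_, ?_, ?_, rfl⟩ <;> exact fun h₀ => h (by funext; simp [T, outer, h₀])
  · rw [Equiv.sum_comp s.equivFin.symm fun r : s => T r, Finset.sum_coe_sort s T,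
      Finset.sum_filter_ne_zero]

theorem unfolding_sum_outer {ρ : Type*} [Fintype ρ] [DecidableEq ρ] (a : ρ → Fin I → ℝ)
    (b : ρ → Fin J → ℝ) (c : ρ → Fin 2 → ℝ) :
    (∑ r, outer (a r) (b r) (c r)).unfolding =
      (of a)ᵀ * fromCols (diagonal (c · 0) * of b) (diagonal (c · 1) * of b) := by
  rw [mul_fromCols, ← Matrix.mul_assoc, ← Matrix.mul_assoc]
  ext i (j | j)
  · rw [fromCols_apply_inl, mul_apply]
    simp [unfolding, slice, outer, mul_right_comm]
  · rw [fromCols_apply_inr, mul_apply]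
    simp [unfolding, slice, outer, mul_right_comm]

theorem rank_unfolding_le_rank (Y : ThreeWayArray I J 2) : Y.unfolding.rank ≤ Y.rank := by
  obtain ⟨T, hT, hY⟩ := (isLeast_rank Y).1
  choose a b c _ _ _ hT using hT
  rw [funext hT] at hY
  conv_lhs => rw [hY, unfolding_sum_outer]
  exact (rank_mul_le_left _ _).trans (by simpa using rank_le_card_width (of a)ᵀ)

theorem rank_le_card_of_unfolding_eq_mul {ρ : Type*} [Fintype ρ] [DecidableEq ρ]
    {Y : ThreeWayArray I J 2} {L : Matrix (Fin I) ρ ℝ} {N : Matrix ρ (Fin J ⊕ Fin J) ℝ}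
    (hY : Y.unfolding = L * N) (hN : HasLeftEigenbasis N) : Y.rank ≤ Fintype.card ρ := by
  obtain ⟨G, s, hG, hs⟩ := hN
  have hsum : Y = ∑ r, outer ((L * G⁻¹).col r) ((G * N.toCols₂).row r) ![s r, 1] := by
    refine unfoldingEquiv.injective ?_
    rw [unfoldingEquiv_apply, unfoldingEquiv_apply, unfolding_sum_outer, hY]
    have hGN : fromCols (diagonal s * (G * N.toCols₂)) (G * N.toCols₂) = G * N := by
      rw [← hs, ← mul_fromCols, fromCols_toCols]
    calc L * N = L * G⁻¹ * (G * N) := by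
          rw [Matrix.mul_assoc, nonsing_inv_mul_cancel_left _ _ hG]
      _ = _ := by
          rw [← hGN]
          simp only [cons_val_zero, cons_val_one, diagonal_one, Matrix.one_mul]
          rfl
  rw [hsum]
  exact rank_sum_outer_le _ _ _

end Rank

section Optimal

theorem norm_toLp (Y : ThreeWayArray I J K) : ‖WithLp.toLp 2 Y‖ = frobeniusNorm Y := by
  simp [EuclideanSpace.norm_eq, frobeniusNorm]

theorem isClosed_W : IsClosed (W I J R) :=
  (isClosed_setOf_rank_le R).preimage
    (LinearMap.continuous_of_finiteDimensional unfoldingEquiv.toLinearMap)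

theorem zero_mem_W : 0 ∈ W I J R := by
  have h : (0 : ThreeWayArray I J 2).unfolding = 0 := map_zero unfoldingEquiv
  simp [W, h]

theorem isOptimalSolution_iff_isNearestPoint {Z X : ThreeWayArray I J 2} :
    IsOptimalSolution R Z X ↔
      IsNearestPoint (WithLp.ofLp ⁻¹' W I J R) (WithLp.toLp 2 Z) (WithLp.toLp 2 X) := by
  have hdist (Y : ThreeWayArray I J 2) :
      dist (WithLp.toLp 2 Z) (WithLp.toLp 2 Y) = frobeniusNorm (Z - Y) := by
    rw [dist_eq_norm, ← WithLp.toLp_sub, norm_toLp]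
  refine and_congr_right fun hX => ?_
  have hX' : WithLp.toLp 2 X ∈ WithLp.ofLp ⁻¹' W I J R := hX
  rw [eq_comm, ← (infDist_le_dist_of_mem hX').ge_iff_eq, le_infDist ⟨_, hX'⟩,
    (WithLp.toLp_surjective 2).forall]
  simp only [hdist, Set.mem_preimage]
  exact forall₂_congr fun Y _ => sq_le_sq₀ (Real.sqrt_nonneg _) (Real.sqrt_nonneg _)

theorem ae_existsUnique_isOptimalSolution (I J R : ℕ) :
    ∀ᵐ Z : ThreeWayArray I J 2, ∃! X, IsOptimalSolution R Z X := by
  have hcl : IsClosed (WithLp.ofLp ⁻¹' W I J R : Set (EuclideanSpace ℝ (Fin I × Fin J × Fin 2))) :=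
    isClosed_W.preimage (PiLp.continuous_ofLp 2 _)
  filter_upwards [(PiLp.volume_preserving_toLp _).quasiMeasurePreserving.ae
    (ae_existsUnique_isNearestPoint volume hcl ⟨0, zero_mem_W⟩)] with Z hZ
  simp only [isOptimalSolution_iff_isNearestPoint]
  exact ((WithLp.equiv 2 (ThreeWayArray I J 2)).existsUnique_congr_left).1 hZ

namespace IsOptimalSolution

variable {Z X : ThreeWayArray I J 2}

theorem trace_mul_transpose_eq_zero (hX : IsOptimalSolution R Z X)
    {M : Matrix (Fin I) (Fin J ⊕ Fin J) ℝ} (hM : ∀ t : ℝ, (X.unfolding + t • M).rank ≤ R) :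
    trace ((Z - X).unfolding * Mᵀ) = 0 := by
  have hunf : (unfoldingEquiv.symm M).unfolding = M := unfoldingEquiv.apply_symm_apply M
  have hline (t : ℝ) : X + t • unfoldingEquiv.symm M ∈ W I J R := by
    have h : (X + t • unfoldingEquiv.symm M).unfolding = X.unfolding + t • M := by
      rw [← unfoldingEquiv_apply, map_add, map_smul, LinearEquiv.apply_symm_apply]; rfl
    exact (congrArg Matrix.rank h).trans_le (hM t)
  have h := (isOptimalSolution_iff_isNearestPoint.1 hX).inner_eq_zero_of_line_mem
    (v := WithLp.toLp 2 (unfoldingEquiv.symm M)) hline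
  rwa [← WithLp.toLp_sub, inner_toLp_eq_trace, hunf] at h

theorem unfolding_mul_transpose (hX : IsOptimalSolution R Z X) :
    (Z - X).unfolding * X.unfoldingᵀ = 0 := by
  refine ext_iff_trace_mul_right.2 fun B => ?_
  have h := hX.trace_mul_transpose_eq_zero (M := Bᵀ * X.unfolding) fun t => by
    have ht : X.unfolding + t • (Bᵀ * X.unfolding) = (1 + t • Bᵀ) * X.unfolding := by
      rw [Matrix.add_mul, Matrix.one_mul, Matrix.smul_mul]
    exact ht ▸ (rank_mul_le_right _ _).trans hX.1
  rw [transpose_mul, transpose_transpose, ← Matrix.mul_assoc] at h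
  rw [h, Matrix.zero_mul, trace_zero]

theorem transpose_mul_unfolding (hX : IsOptimalSolution R Z X) :
    X.unfoldingᵀ * (Z - X).unfolding = 0 := by
  refine ext_iff_trace_mul_left.2 fun B => ?_
  have h := hX.trace_mul_transpose_eq_zero (M := X.unfolding * Bᵀ) fun t => by
    have ht : X.unfolding + t • (X.unfolding * Bᵀ) = X.unfolding * (1 + t • Bᵀ) := by
      rw [Matrix.mul_add, Matrix.mul_one, Matrix.mul_smul]
    exact ht ▸ (rank_mul_le_left _ _).trans hX.1
  rw [transpose_mul, transpose_transpose, trace_mul_comm, Matrix.mul_assoc] at h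
  rw [h, Matrix.mul_zero, trace_zero]

theorem eq_of_rank_unfolding_lt (hX : IsOptimalSolution R Z X) (hlt : X.unfolding.rank < R) :
    Z = X := by
  have h : (Z - X).unfolding = 0 := by
    ext i j
    have h := hX.trace_mul_transpose_eq_zero (M := single i j 1) fun t => by
      have hrank : (t • single i j (1 : ℝ)).rank ≤ 1 := by
        rw [single_eq_single_vecMulVec_single, ← smul_vecMulVec]
        exact rank_vecMulVec_le _ _
      exact (rank_add_le_rank_add_rank _ _).trans (by lia)
    simpa [transpose_single, trace_mul_single] using h
  exact sub_eq_zero.1 (unfoldingEquiv.map_eq_zero_iff.1 h)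

theorem rank_unfolding_eq (hX : IsOptimalSolution R Z X) (hZ : R ≤ Z.unfolding.rank) :
    X.unfolding.rank = R := by
  refine hX.1.antisymm (not_lt.1 fun hlt => ?_)
  exact (hX.eq_of_rank_unfolding_lt hlt ▸ hlt).not_ge hZ

end IsOptimalSolution

end Optimal

section Generic

theorem ae_le_rank_unfolding (hI : R ≤ I) (hJ : R ≤ 2 * J) :
    ∀ᵐ Z : ThreeWayArray I J 2, R ≤ Z.unfolding.rank := by
  obtain ⟨f⟩ := Function.Embedding.nonempty_of_card_le (α := Fin R) (β := Fin I) (by simpa)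
  obtain ⟨e⟩ := Function.Embedding.nonempty_of_card_le (α := Fin R) (β := Fin J ⊕ Fin J)
    (by simpa [← two_mul])
  let x : ThreeWayArray I J 2 :=
    unfoldingEquiv.symm (of (Function.extend f (fun r => Pi.single (e r) 1) 0))
  have hx : x.unfolding.submatrix f e = 1 := by
    rw [← unfoldingEquiv_apply, LinearEquiv.apply_symm_apply]
    ext r r'
    simp [f.injective.extend_apply, Pi.single_apply, one_apply, eq_comm]
  filter_upwards [ae_ne_zero_of_analyticOnNhd volume
    (isEntrywiseAnalytic_unfolding.submatrix f e).det (x₀ := x) (by simp [hx])] with Z hZ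
  calc R = (Z.unfolding.submatrix f e).rank := by simp [rank_of_det_ne_zero hZ]
    _ ≤ Z.unfolding.rank := rank_submatrix_le _ _ _

theorem ae_hasLeftEigenbasis {κ : Type*} [Fintype κ] [DecidableEq κ] [Nonempty κ]
    {g : Fin J ⊕ κ → Fin I} (hg : Function.Injective g) :
    ∀ᵐ x : ThreeWayArray I J 2, HasLeftEigenbasis (x.unfolding.submatrix g id) := by
  obtain ⟨k⟩ := ‹Nonempty κ›
  let s : Fin J ⊕ κ ↪ ℝ :=
    (Fintype.equivFin _).toEmbedding.trans (Fin.valEmbedding.trans Nat.castEmbedding)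
  let x : ThreeWayArray I J 2 :=
    unfoldingEquiv.symm (of (Function.extend g (eigenbasisWitness s k) 0))
  have hx : x.unfolding.submatrix g id = eigenbasisWitness s k := by
    rw [← unfoldingEquiv_apply, LinearEquiv.apply_symm_apply]
    ext r j
    exact congrFun (hg.extend_apply (eigenbasisWitness s k) 0 r) j
  have hN := (isEntrywiseAnalytic_unfolding (I := I) (J := J)).submatrix g id
  have hx₀ : (leftEigenmatrix s (eigenbasisBorder k) k (x.unfolding.submatrix g id)).det ≠ 0 :=
    hx ▸ det_leftEigenmatrix_eigenbasisWitness_ne_zero s.injective k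
  filter_upwards [ae_ne_zero_of_analyticOnNhd volume
    (hN.leftEigenmatrix s (eigenbasisBorder k) k).det hx₀] with x hx
  exact hasLeftEigenbasis_of_det_leftEigenmatrix_ne_zero hx

section NormalMap

variable {κ π δ : Type*} [Fintype κ] [DecidableEq κ] [Fintype π] [DecidableEq π] [Fintype δ]
  [DecidableEq δ] (f : (Fin J ⊕ κ) ⊕ π ≃ Fin I) (e : (Fin J ⊕ κ) ⊕ δ ≃ Fin J ⊕ Fin J)

/-- `normalForm` as a map of arrays, the rows and columns of the unfolding being ordered by `f` and
`e`. -/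
noncomputable def normalMap (x : ThreeWayArray I J 2) : ThreeWayArray I J 2 :=
  unfoldingEquiv.symm ((normalForm (x.unfolding.submatrix f e)).submatrix f.symm e.symm)

theorem unfolding_normalMap (x : ThreeWayArray I J 2) : (normalMap f e x).unfolding =
    (normalForm (x.unfolding.submatrix f e)).submatrix f.symm e.symm :=
  unfoldingEquiv.apply_symm_apply _

theorem differentiable_normalMap : Differentiable ℝ (normalMap f e) := by
  refine differentiable_of_isEntrywiseAnalytic_unfolding ?_
  simp only [unfolding_normalMap]
  exact (isEntrywiseAnalytic_unfolding.submatrix f e).normalForm.submatrix f.symm e.symm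

theorem ae_forall_normalMap_eq_imp_hasLeftEigenbasis [Nonempty κ] :
    ∀ᵐ Z : ThreeWayArray I J 2, ∀ x, normalMap f e x = Z →
      HasLeftEigenbasis (x.unfolding.submatrix (f ∘ Sum.inl) id) := by
  have hnull := ae_iff.1 (ae_hasLeftEigenbasis (J := J) (f.injective.comp Sum.inl_injective))
  filter_upwards [measure_eq_zero_iff_ae_notMem.1
    (addHaar_image_eq_zero_of_differentiableOn_of_addHaar_eq_zero volume
      (differentiable_normalMap f e).differentiableOn hnull)] with Z hZ x hx
  exact by_contra fun h => hZ ⟨x, h, hx⟩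

theorem IsOptimalSolution.exists_chart {Z X : ThreeWayArray I J 2} (hX : IsOptimalSolution R Z X)
    (hXR : X.unfolding.rank = Fintype.card (Fin J ⊕ κ))
    (hI : I = Fintype.card (Fin J ⊕ κ) + Fintype.card π)
    (hJ : J + J = Fintype.card (Fin J ⊕ κ) + Fintype.card δ) :
    ∃ (f : (Fin J ⊕ κ) ⊕ π ≃ Fin I) (e : (Fin J ⊕ κ) ⊕ δ ≃ Fin J ⊕ Fin J)
      (E : Matrix π (Fin J ⊕ κ) ℝ) (x : ThreeWayArray I J 2), normalMap f e x = Z ∧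
        X.unfolding = (fromRows 1 E).submatrix f.symm id *
          x.unfolding.submatrix (f ∘ Sum.inl) id := by
  obtain ⟨f, e, A, B, E, hA, hXf⟩ := exists_submatrix_eq_fromRows_mul_fromCols (π := π) (δ := δ)
    X.unfolding hXR (by simpa using hI) (by simpa using hJ)
  obtain ⟨D, hD⟩ := exists_eq_normalForm hA B E (U := (Z - X).unfolding.submatrix f e)
    (by rw [← hXf, transpose_submatrix, submatrix_mul_equiv, hX.transpose_mul_unfolding]; rfl)
    (by rw [← hXf, transpose_submatrix, submatrix_mul_equiv, hX.unfolding_mul_transpose]; rfl)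
  let x : ThreeWayArray I J 2 :=
    unfoldingEquiv.symm ((fromBlocks A B E D).submatrix f.symm e.symm)
  have hx : x.unfolding = (fromBlocks A B E D).submatrix f.symm e.symm :=
    unfoldingEquiv.apply_symm_apply _
  refine ⟨f, e, E, x, unfoldingEquiv.injective ?_, ?_⟩
  · have hZ : Z.unfolding = X.unfolding + (Z - X).unfolding := by
      simp_rw [← unfoldingEquiv_apply, map_sub, add_sub_cancel]
    rw [unfoldingEquiv_apply, unfoldingEquiv_apply, unfolding_normalMap, hx, hZ]
    simp [← hD, ← hXf, submatrix_add]
  · have hXe : X.unfolding = (fromRows 1 E * fromCols A B).submatrix f.symm e.symm := by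
      simp [← hXf]
    rw [hXe, hx, ← submatrix_mul_equiv _ _ _ (Equiv.refl _)]
    congr 1
    ext r j
    obtain ⟨j | j, rfl⟩ := e.surjective j <;> simp

end NormalMap

theorem ae_forall_isOptimalSolution_rank_eq {κ π δ : Type*} [Fintype κ] [Nonempty κ] [Fintype π]
    [Fintype δ] (hI : I = Fintype.card (Fin J ⊕ κ) + Fintype.card π)
    (hJ : J + J = Fintype.card (Fin J ⊕ κ) + Fintype.card δ) :
    ∀ᵐ Z : ThreeWayArray I J 2, ∀ X,
      IsOptimalSolution (Fintype.card (Fin J ⊕ κ)) Z X → X.rank = Fintype.card (Fin J ⊕ κ) := by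
  classical
  have hchart := ae_all_iff.2 fun f : (Fin J ⊕ κ) ⊕ π ≃ Fin I =>
    ae_all_iff.2 fun e : (Fin J ⊕ κ) ⊕ δ ≃ Fin J ⊕ Fin J =>
      ae_forall_normalMap_eq_imp_hasLeftEigenbasis f e
  filter_upwards [hchart, ae_le_rank_unfolding (hI.symm ▸ Nat.le_add_right _ _)
    (two_mul J ▸ hJ.symm ▸ Nat.le_add_right _ _)] with Z hZ hrank X hX
  have hXR := hX.rank_unfolding_eq hrank
  obtain ⟨f, e, E, x, hxZ, hXx⟩ := hX.exists_chart hXR hI hJ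
  exact (rank_le_card_of_unfolding_eq_mul hXx (hZ f e x hxZ)).antisymm
    (hXR.symm.trans_le X.rank_unfolding_le_rank)

end Generic

end ThreeWayArray

theorem theorem4p1_general (I J R : ℕ) (hJR : J < R) (hR : R ≤ min I (2 * J)) :
    ∀ᵐ Z : ThreeWayArray I J 2 ∂MeasureTheory.volume,
      (∃! X : ThreeWayArray I J 2, ThreeWayArray.IsOptimalSolution R Z X) ∧
        ∀ X : ThreeWayArray I J 2, ThreeWayArray.IsOptimalSolution R Z X → X.rank = R := by
  obtain ⟨hI, hJ⟩ := le_min_iff.1 hR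
  have : NeZero (R - J) := ⟨Nat.sub_ne_zero_of_lt hJR⟩
  have hcard : Fintype.card (Fin J ⊕ Fin (R - J)) = R := by
    rw [Fintype.card_sum, Fintype.card_fin, Fintype.card_fin, Nat.add_sub_of_le hJR.le]
  have hrank := ThreeWayArray.ae_forall_isOptimalSolution_rank_eq (I := I) (J := J)
    (κ := Fin (R - J)) (π := Fin (I - R)) (δ := Fin (2 * J - R))
    (by rw [hcard, Fintype.card_fin]; lia) (by rw [hcard, Fintype.card_fin]; lia)
  rw [hcard] at hrank
  exact (ThreeWayArray.ae_existsUnique_isOptimalSolution I J R).and hrank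

theorem theorem4p1 (I J R : ℕ) (hJ : 2 ≤ J) (hIJ : J < I) (hJR : J < R) (hR : R < min I (2 * J)) :
    ∀ᵐ Z : ThreeWayArray I J 2 ∂MeasureTheory.volume,
      (∃! X : ThreeWayArray I J 2, ThreeWayArray.IsOptimalSolution R Z X) ∧
        ∀ X : ThreeWayArray I J 2, ThreeWayArray.IsOptimalSolution R Z X → X.rank = R :=
  theorem4p1_general I J R hJR hR.le
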